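/- Let $F$ be a continuous distribution function supported on $[1,\infty)$ and let $\alpha>0$. Suppose that $\overline F=1-F$ is regularly varying with index $-\alpha$, i.e. $\lim_{t\to\infty}\overline F(tx)/\overline F(t)=x^{-\alpha}$ for every $x>0$. Let $X_1,X_2,\dots$ be i.i.d. random variables with distribution function $F$, and let $X_{1:n}\le\cdots\le X_{n:n}$ be the order statistics of $X_1,\dots,X_n$. For $1\le k\le n-1$ let $$\widehat\alpha_{n,k}=\Big(\frac1k\sum_{i=1}^k\log\frac{X_{n-k+i:n}}{X_{n-k:n}}\Big)^{-1},\qquad D_{n,k}=\sup_{y\ge1}\Big|\frac1k\sum_{i=1}^k\mathbb 1_{(y,\infty)}\Big(\frac{X_{n-k+i:n}}{X_{n-k:n}}\Big)-y^{-\widehat\alpha_{n,k}}\Big|$$ (these are almost surely well defined, since ties have probability zero), and for $n\ge2$ let $\kappa_n^\star$ be the smallest minimizer of $k\mapsto D_{n,k}$ over $1\le k\le n-1$. Then $$D_{n,\kappa_n^\star}=\min_{1\le k\le n-1}D_{n,k}\longrightarrow 0\quad\text{in probability as } n\to\infty .$$ -/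

import Mathlib

namespace PLFit

/-- The tail `1 - F` is regularly varying (at infinity) with index `-α`. -/
def RegularlyVaryingTail (F : ℝ → ℝ) (α : ℝ) : Prop :=
  ∀ x : ℝ, 0 < x →
    Filter.Tendsto (fun t : ℝ => (1 - F (t * x)) / (1 - F t)) Filter.atTop (nhds (x ^ (-α)))

/-- The order statistic `X_{j:n}` (the `j`-th smallest value, `1 ≤ j ≤ n`) of the first `n` terms
`x 0, …, x (n - 1)` of a sequence. Outside the range `1 ≤ j ≤ n` the value is `0`; such indices
are not used below. -/
noncomputable def orderStat (x : ℕ → ℝ) (n j : ℕ) : ℝ :=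
  if h : 1 ≤ j ∧ j ≤ n then
    x (Tuple.sort (fun i : Fin n => x i) ⟨j - 1, by omega⟩)
  else 0

/-- `H_{n,k}`, the mean log-excess of the `k` largest observations over `X_{n-k:n}`. -/
noncomputable def hill (x : ℕ → ℝ) (n k : ℕ) : ℝ :=
  (1 / (k : ℝ)) * ∑ i ∈ Finset.Icc 1 k,
    Real.log (orderStat x n (n - k + i) / orderStat x n (n - k))

/-- Hill's estimator of the tail index, the reciprocal of `H_{n,k}`. -/
noncomputable def hillEstimator (x : ℕ → ℝ) (n k : ℕ) : ℝ := (hill x n k)⁻¹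

/-- The Kolmogorov–Smirnov distance `D_{n,k}`, for `1 ≤ k ≤ n - 1`, between the empirical tail of
the ratios `X_{n-k+i:n} / X_{n-k:n}`, `1 ≤ i ≤ k`, and the Pareto tail on `[1, ∞)` whose exponent
is Hill's estimator. -/
noncomputable def ksDist (x : ℕ → ℝ) (n k : ℕ) : ℝ :=
  ⨆ y : Set.Ici (1 : ℝ),
    |(1 / (k : ℝ)) * ∑ i ∈ Finset.Icc 1 k,
        (Set.Ioi (y : ℝ)).indicator (fun _ => (1 : ℝ))
          (orderStat x n (n - k + i) / orderStat x n (n - k))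
      - (y : ℝ) ^ (-hillEstimator x n k)|

/-- The optimizer `κ_n^⋆`: the smallest minimizer of `k ↦ D_{n,k}` over `1 ≤ k ≤ n - 1`
(there is one as soon as `2 ≤ n`). -/
noncomputable def kappaStar (x : ℕ → ℝ) (n : ℕ) : ℕ :=
  sInf {k | k ∈ Finset.Icc 1 (n - 1) ∧ ∀ j ∈ Finset.Icc 1 (n - 1), ksDist x n k ≤ ksDist x n j}

/-- For `2 ≤ n` the minimum over `1 ≤ k ≤ n - 1` is attained at `κ_n^⋆`. -/
theorem kappaStar_spec (x : ℕ → ℝ) {n : ℕ} (hn : 2 ≤ n) :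
    kappaStar x n ∈ Finset.Icc 1 (n - 1) ∧
      ∀ j ∈ Finset.Icc 1 (n - 1), ksDist x n (kappaStar x n) ≤ ksDist x n j := by
  have hne : (Finset.Icc 1 (n - 1)).Nonempty := ⟨1, by simp; omega⟩
  obtain ⟨k, hk, hmin⟩ := Finset.exists_min_image _ (ksDist x n) hne
  exact Nat.sInf_mem (s := {k | k ∈ Finset.Icc 1 (n - 1) ∧
    ∀ j ∈ Finset.Icc 1 (n - 1), ksDist x n k ≤ ksDist x n j}) ⟨k, hk, hmin⟩

end PLFit

/-! Since `kappaStar` minimizes, it suffices to exhibit one `k` whose distance is small with high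
probability. Take `k = tailCount x n t`, with a deterministic `t` such that `n * (1 - F t) = K`; the
constant `K` depends on the accuracy only, not on `n`, so no intermediate sequence is needed.

Put a geometric grid `t * exp (j * h)` above `t`. Regular variation makes the expected counts at
finitely many grid points close to `K * exp (-(α * h * j))`, and for large `K` Chebyshev makes the
actual counts close to them (`measure_tailCount_sub_ge_le`). A geometric bound on `1 - F` and Markov
control the log-excess beyond the grid (`measure_sum_logExcess_ge_le`). On this event the rest is
deterministic: monotonicity in `y` gives the empirical tail (`abs_empirical_tail_sub_le`), a Riemann
sum gives Hill's estimator (`abs_hill_sub_le`), and `exists_ksDist_le` combines them. -/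

namespace PLFit

open Finset

/-! ### Order statistics through tail counts. -/

/-- The number of the first `n` terms of `x` that exceed `s`. -/
noncomputable def tailCount (x : ℕ → ℝ) (n : ℕ) (s : ℝ) : ℕ := #{i : Fin n | s < x i}

/-- The log-excess of `u` over the threshold `s`. -/
noncomputable def logExcess (s u : ℝ) : ℝ := if s < u then Real.log (u / s) else 0

theorem tailCount_anti (x : ℕ → ℝ) (n : ℕ) {s s' : ℝ} (h : s ≤ s') :
    tailCount x n s' ≤ tailCount x n s :=
  card_le_card (monotone_filter_right _ fun _ _ hi => h.trans_lt hi)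

theorem tailCount_le (x : ℕ → ℝ) (n : ℕ) (s : ℝ) : tailCount x n s ≤ n := by
  simpa [tailCount] using card_filter_le (univ : Finset (Fin n)) (fun i => s < x i)

theorem tailCount_sort (x : ℕ → ℝ) (n : ℕ) (s : ℝ) :
    #{i : Fin n | s < x (Tuple.sort (fun i : Fin n => x i) i)} = tailCount x n s := by
  unfold tailCount
  rw [card_filter, card_filter]
  exact Equiv.sum_comp (Tuple.sort (fun i : Fin n => x i)) (fun i : Fin n => if s < x i then 1 else 0)

/-- After sorting, the terms above `s` occupy the last positions; comparing their number with the
sizes of `Ici j` and `Iic j` locates `j`. -/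
theorem lt_sort_iff (x : ℕ → ℝ) (n : ℕ) (s : ℝ) (j : Fin n) :
    s < x (Tuple.sort (fun i : Fin n => x i) j) ↔ n - tailCount x n s ≤ j := by
  have hmono : Monotone fun j : Fin n => x (Tuple.sort (fun i : Fin n => x i) j) :=
    Tuple.monotone_sort (fun i : Fin n => x i)
  have hj := j.2
  rw [← tailCount_sort]
  constructor
  · intro h
    have : Ici j ⊆ univ.filter fun i => s < x (Tuple.sort (fun i : Fin n => x i) i) := fun i hi => by
      simpa using h.trans_le (hmono (mem_Ici.1 hi))
    have := card_le_card this
    rw [Fin.card_Ici] at this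
    omega
  · intro h
    by_contra! hs
    have : Iic j ⊆ univ.filter fun i => ¬ s < x (Tuple.sort (fun i : Fin n => x i) i) := fun i hi => by
      simpa using (hmono (mem_Iic.1 hi)).trans hs
    have := card_le_card this
    rw [Fin.card_Iic] at this
    have h2 := card_filter_add_card_filter_not (s := (univ : Finset (Fin n)))
      (fun i => s < x (Tuple.sort (fun i : Fin n => x i) i))
    simp only [card_univ, Fintype.card_fin] at h2
    omega

theorem lt_orderStat_iff (x : ℕ → ℝ) {n j : ℕ} (s : ℝ) (h1 : 1 ≤ j) (hn : j ≤ n) :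
    s < orderStat x n j ↔ n < j + tailCount x n s := by
  have := tailCount_le x n s
  rw [orderStat, dif_pos ⟨h1, hn⟩, lt_sort_iff]
  simp only
  omega

/-- The `tailCount x n t` largest order statistics are the terms that exceed `t`. -/
theorem sum_orderStat_top (x : ℕ → ℝ) (n : ℕ) (t : ℝ) (φ : ℝ → ℝ) :
    ∑ i ∈ Icc 1 (tailCount x n t), φ (orderStat x n (n - tailCount x n t + i)) =
      ∑ i : Fin n, if t < x i then φ (x i) else 0 := by
  rw [← Equiv.sum_comp (Tuple.sort (fun i : Fin n => x i)), ← sum_filter]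
  have hk := tailCount_le x n t
  refine sum_bij' (fun i hi => (⟨n - tailCount x n t + i - 1, by
      have := mem_Icc.1 hi; omega⟩ : Fin n))
    (fun j _ => (j : ℕ) + 1 - (n - tailCount x n t)) ?_ ?_ ?_ ?_ ?_
  · intro i hi
    have := mem_Icc.1 hi
    simp only [mem_filter, mem_univ, true_and, lt_sort_iff]
    omega
  · intro j hj
    simp only [mem_filter, mem_univ, true_and, lt_sort_iff] at hj
    have := j.2
    simp only [mem_Icc]
    omega
  · intro i hi
    have := mem_Icc.1 hi
    simp only
    omega
  · intro j hj
    simp only [mem_filter, mem_univ, true_and, lt_sort_iff] at hj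
    ext
    simp only
    omega
  · intro i hi
    have := mem_Icc.1 hi
    rw [orderStat, dif_pos (by omega)]

/-! ### Discretization of the log-excess, and comparison of Pareto tails. -/

theorem logExcess_nonneg {s u : ℝ} (hs : 0 < s) : 0 ≤ logExcess s u := by
  unfold logExcess
  split_ifs with h
  · exact Real.log_nonneg (by rw [le_div_iff₀ hs]; linarith)
  · exact le_rfl

theorem logExcess_step {s u h : ℝ} (hs : 0 < s) (hh : 0 < h) :
    logExcess s u ≤ (if s < u then h else 0) + logExcess (s * Real.exp h) u ∧
    (if s * Real.exp h < u then h else 0) + logExcess (s * Real.exp h) u ≤ logExcess s u := by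
  have hb : s < s * Real.exp h := by
    have := Real.one_lt_exp_iff.2 hh
    nlinarith
  have key : s < u → Real.log (u / (s * Real.exp h)) = Real.log (u / s) - h := by
    intro hu
    rw [← div_div, Real.log_div (by have := hs.trans hu; positivity) (Real.exp_pos h).ne',
      Real.log_exp]
  unfold logExcess
  by_cases h1 : s < u
  · by_cases h2 : s * Real.exp h < u
    · simp only [h1, h2, if_true, key h1]
      constructor <;> linarith
    · simp only [h1, h2, if_true, if_false]
      have h3 : Real.log (u / s) ≤ h := by
        rw [Real.log_le_iff_le_exp (div_pos (hs.trans h1) hs), div_le_iff₀ hs]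
        linarith
      have h4 : 0 ≤ Real.log (u / s) := Real.log_nonneg (by rw [le_div_iff₀ hs]; linarith)
      constructor <;> linarith
  · have h2 : ¬ s * Real.exp h < u := by linarith
    simp [h1, h2]

/-- The log-excess is the integral over `v ≥ 0` of the indicator of `t * exp v < u`; these are its
upper and lower Riemann sums of mesh `h`, with the part beyond the grid kept apart. -/
theorem logExcess_bounds {t u h : ℝ} (ht : 0 < t) (hh : 0 < h) (L : ℕ) :
    logExcess t u ≤ h * ∑ j ∈ range L, (if t * Real.exp (j * h) < u then 1 else 0)
        + logExcess (t * Real.exp (L * h)) u ∧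
    h * ∑ j ∈ range L, (if t * Real.exp ((j + 1 : ℕ) * h) < u then 1 else 0)
        + logExcess (t * Real.exp (L * h)) u ≤ logExcess t u := by
  induction L with
  | zero => simp
  | succ L ih =>
    have := logExcess_step (s := t * Real.exp (L * h)) (u := u) (by positivity) hh
    have he : t * Real.exp (L * h) * Real.exp h = t * Real.exp ((L + 1 : ℕ) * h) := by
      rw [mul_assoc, ← Real.exp_add]
      push_cast
      ring_nf
    rw [he] at this
    rw [sum_range_succ, sum_range_succ, mul_add, mul_add, mul_ite, mul_ite, mul_one, mul_zero]
    constructor <;> linarith [ih.1, ih.2, this.1, this.2]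

theorem cast_tailCount (x : ℕ → ℝ) (n : ℕ) (s : ℝ) :
    (tailCount x n s : ℝ) = ∑ i : Fin n, if s < x i then 1 else 0 := by
  simp [tailCount]

theorem sum_logExcess_bounds (x : ℕ → ℝ) (n : ℕ) {t h : ℝ} (ht : 0 < t) (hh : 0 < h) (L : ℕ) :
    ∑ i : Fin n, logExcess t (x i) ≤ h * ∑ j ∈ range L, (tailCount x n (t * Real.exp (j * h)) : ℝ)
        + ∑ i : Fin n, logExcess (t * Real.exp (L * h)) (x i) ∧
    h * ∑ j ∈ range L, (tailCount x n (t * Real.exp ((j + 1 : ℕ) * h)) : ℝ)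
        ≤ ∑ i : Fin n, logExcess t (x i) := by
  simp only [cast_tailCount]
  rw [sum_comm, sum_comm (s := range L), mul_sum, mul_sum, ← sum_add_distrib]
  constructor
  · exact sum_le_sum fun i _ => (logExcess_bounds ht hh L).1
  · refine sum_le_sum fun i _ => ?_
    have := (logExcess_bounds (u := x i) ht hh L).2
    have := logExcess_nonneg (s := t * Real.exp (L * h)) (u := x i) (by positivity)
    linarith

/-- For `a ≤ b` and `s = log y`, the difference is at most `exp (-(a * s)) * (b - a) * s`, and `exp
(-(a * s)) * (a * s) ≤ 1`. Reciprocals appear because `hill` estimates `α⁻¹`. -/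
theorem abs_rpow_neg_sub_le {a b y : ℝ} (ha : 0 < a) (hb : 0 < b) (hy : 1 ≤ y) :
    |y ^ (-a) - y ^ (-b)| ≤ |a⁻¹ - b⁻¹| / min a⁻¹ b⁻¹ := by
  wlog hab : a ≤ b generalizing a b with H
  · rw [abs_sub_comm, abs_sub_comm a⁻¹, min_comm]
    exact H hb ha (le_of_not_ge hab)
  have hy0 : 0 < y := by linarith
  have hinv : b⁻¹ ≤ a⁻¹ := inv_anti₀ ha hab
  rw [min_eq_right hinv, abs_of_nonneg (sub_nonneg.2 hinv),
    abs_of_nonneg (sub_nonneg.2 (Real.rpow_le_rpow_of_exponent_le hy (by linarith)))]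
  have h1 : (a⁻¹ - b⁻¹) / b⁻¹ = (b - a) / a := by field_simp
  rw [h1, le_div_iff₀ ha, Real.rpow_def_of_pos hy0, Real.rpow_def_of_pos hy0]
  set s := Real.log y with hs
  have hs0 : 0 ≤ s := Real.log_nonneg hy
  have e1 : Real.exp (s * -b) = Real.exp (s * -a) * Real.exp (-((b - a) * s)) := by
    rw [← Real.exp_add]; ring_nf
  have e2 : 1 - (b - a) * s ≤ Real.exp (-((b - a) * s)) := by
    have := Real.add_one_le_exp (-((b - a) * s)); linarith
  have e3 : Real.exp (s * -a) * (a * s) ≤ 1 := by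
    have h := Real.add_one_le_exp (a * s)
    have h2 : Real.exp (s * -a) * Real.exp (a * s) = 1 := by
      rw [← Real.exp_add]; ring_nf; exact Real.exp_zero
    have h3 := Real.exp_pos (s * -a)
    nlinarith
  rw [e1]
  have h3 := Real.exp_pos (s * -a)
  calc _ = Real.exp (s * -a) * a * (1 - Real.exp (-((b - a) * s))) := by ring
    _ ≤ Real.exp (s * -a) * a * ((b - a) * s) := by gcongr; linarith
    _ = (Real.exp (s * -a) * (a * s)) * (b - a) := by ring
    _ ≤ 1 * (b - a) := by gcongr
    _ = _ := one_mul _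

end PLFit

/-! ### Deterministic estimates on the grid. -/

namespace PLFit

open Finset

/-- By `hlow` some observation lies in `(t * exp (-h), t]`, hence so does the largest one not
exceeding `t`. The random threshold can thus be replaced by `t` at the cost of one grid step. -/
theorem orderStat_threshold (x : ℕ → ℝ) {n : ℕ} {t h : ℝ}
    (hlow : tailCount x n t < tailCount x n (t * Real.exp (-h))) :
    t * Real.exp (-h) < orderStat x n (n - tailCount x n t) ∧
      orderStat x n (n - tailCount x n t) ≤ t := by
  have := tailCount_le x n (t * Real.exp (-h))
  refine ⟨?_, not_lt.1 ?_⟩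
  · rw [lt_orderStat_iff x _ (by omega) (by omega)]
    omega
  · rw [lt_orderStat_iff x _ (by omega) (by omega)]
    omega

/-- Moving the threshold from `t` to the order statistic `x0` adds `log (t / x0)`, between `0` and
`h`, to each log-excess. -/
theorem hill_bounds (x : ℕ → ℝ) {n : ℕ} {t h : ℝ} (ht : 0 < t) (hpos : 0 < tailCount x n t)
    (hlow : tailCount x n t < tailCount x n (t * Real.exp (-h))) :
    (∑ i : Fin n, logExcess t (x i)) / tailCount x n t ≤ hill x n (tailCount x n t) ∧
    hill x n (tailCount x n t) ≤ (∑ i : Fin n, logExcess t (x i)) / tailCount x n t + h := by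
  obtain ⟨h1, h2⟩ := orderStat_threshold x hlow
  have hx0 : 0 < orderStat x n (n - tailCount x n t) := lt_trans (by positivity) h1
  unfold hill
  rw [sum_orderStat_top x n t fun u => Real.log (u / orderStat x n (n - tailCount x n t))]
  set x0 := orderStat x n (n - tailCount x n t) with hx0def
  have hk : (0 : ℝ) < tailCount x n t := by exact_mod_cast hpos
  have key : (∑ i : Fin n, if t < x i then Real.log (x i / x0) else 0) =
      ∑ i : Fin n, logExcess t (x i) + tailCount x n t * Real.log (t / x0) := by
    rw [cast_tailCount, sum_mul, ← sum_add_distrib]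
    refine sum_congr rfl fun i _ => ?_
    unfold logExcess
    split_ifs with hi
    · have hxi := ht.trans hi
      rw [one_mul, Real.log_div hxi.ne' hx0.ne', Real.log_div hxi.ne' ht.ne',
        Real.log_div ht.ne' hx0.ne']
      ring
    · simp
  have hl0 : 0 ≤ Real.log (t / x0) := Real.log_nonneg (by rw [le_div_iff₀ hx0]; linarith)
  have hl1 : Real.log (t / x0) ≤ h := by
    rw [Real.log_le_iff_le_exp (by positivity), div_le_iff₀ hx0]
    have h3 := mul_lt_mul_of_pos_right h1 (Real.exp_pos h)
    rw [mul_assoc, ← Real.exp_add, neg_add_cancel, Real.exp_zero] at h3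
    linarith
  rw [key, mul_add, one_div_mul_eq_div, ← mul_assoc, one_div_mul_cancel hk.ne', one_mul]
  constructor <;> linarith

theorem empirical_tail_bounds (x : ℕ → ℝ) {n : ℕ} {t h y : ℝ} (ht : 0 < t)
    (hy : 1 ≤ y) (hpos : 0 < tailCount x n t)
    (hlow : tailCount x n t < tailCount x n (t * Real.exp (-h))) :
    let G := (1 / (tailCount x n t : ℝ)) * ∑ i ∈ Icc 1 (tailCount x n t),
        (Set.Ioi y).indicator (fun _ => (1 : ℝ))
          (orderStat x n (n - tailCount x n t + i) / orderStat x n (n - tailCount x n t))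
    (tailCount x n (t * y) : ℝ) / tailCount x n t ≤ G ∧ G ≤ 1 ∧
      G ≤ (tailCount x n (t * y * Real.exp (-h)) : ℝ) / tailCount x n t := by
  obtain ⟨h1, h2⟩ := orderStat_threshold x hlow
  have hx0 : 0 < orderStat x n (n - tailCount x n t) := lt_trans (by positivity) h1
  intro G
  have hG : G = (∑ i : Fin n, if t < x i then
      (Set.Ioi y).indicator (fun _ => (1 : ℝ)) (x i / orderStat x n (n - tailCount x n t))
      else 0) / tailCount x n t := by
    rw [← one_div_mul_eq_div, ← sum_orderStat_top x n t fun u =>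
      (Set.Ioi y).indicator (fun _ => (1 : ℝ)) (u / orderStat x n (n - tailCount x n t))]
  rw [hG]
  clear_value G
  set x0 := orderStat x n (n - tailCount x n t) with hx0def
  have hk : (0 : ℝ) < tailCount x n t := by exact_mod_cast hpos
  rw [div_le_one hk, div_le_div_iff_of_pos_right hk, div_le_div_iff_of_pos_right hk]
  simp only [cast_tailCount]
  refine ⟨sum_le_sum fun i _ => ?_, sum_le_sum fun i _ => ?_, sum_le_sum fun i _ => ?_⟩
  · by_cases hi : t * y < x i
    · have hti : t < x i := by nlinarith
      have : y < x i / x0 := by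
        rw [lt_div_iff₀ hx0]
        nlinarith
      simp [hi, hti, this]
    · rw [if_neg hi]
      split_ifs
      · exact Set.indicator_nonneg (by simp) _
      · exact le_rfl
  · split_ifs
    · exact Set.indicator_le_self' (by simp) _
    · exact le_rfl
  · by_cases hi : y < x i / x0
    · have : t * y * Real.exp (-h) < x i := by
        rw [lt_div_iff₀ hx0] at hi
        nlinarith
      rw [if_pos this]
      split_ifs
      · exact Set.indicator_le_self' (by simp) _
      · exact zero_le_one
    · have h0 : (Set.Ioi y).indicator (fun _ => (1 : ℝ)) (x i / x0) = 0 :=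
        Set.indicator_of_notMem (by simpa using hi) _
      rw [h0, ite_self]
      split_ifs <;> simp

/-- If the normalized tail counts over a geometric grid follow `q ^ j`, then so does the
empirical tail, uniformly. -/
theorem abs_empirical_tail_sub_le (x : ℕ → ℝ) {n L : ℕ} {t h y α δ : ℝ} (ht : 0 < t) (hh : 0 < h)
    (hα : 0 < α) (hδ : 0 ≤ δ)
    (hy : 1 ≤ y) (hpos : 0 < tailCount x n t)
    (hlow : tailCount x n t < tailCount x n (t * Real.exp (-h)))
    (hG : ∀ j ≤ L + 1, |(tailCount x n (t * Real.exp (j * h)) : ℝ) / tailCount x n t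
      - Real.exp (-(α * h)) ^ j| ≤ δ) :
    |(1 / (tailCount x n t : ℝ)) * ∑ i ∈ Icc 1 (tailCount x n t),
        (Set.Ioi y).indicator (fun _ => (1 : ℝ))
          (orderStat x n (n - tailCount x n t + i) / orderStat x n (n - tailCount x n t))
      - y ^ (-α)| ≤ 2 * (α * h) + Real.exp (-(α * h)) ^ L + δ := by
  obtain ⟨g1, g2, g3⟩ := empirical_tail_bounds x ht hy hpos hlow
  have hk : (0 : ℝ) < tailCount x n t := by exact_mod_cast hpos
  set G := (1 / (tailCount x n t : ℝ)) * ∑ i ∈ Icc 1 (tailCount x n t),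
        (Set.Ioi y).indicator (fun _ => (1 : ℝ))
          (orderStat x n (n - tailCount x n t + i) / orderStat x n (n - tailCount x n t))
  set q := Real.exp (-(α * h)) with hq
  have hq0 : 0 < q := Real.exp_pos _
  have hq1 : q ≤ 1 := Real.exp_le_one_iff.2 (by nlinarith)
  have hqe : 1 - α * h ≤ q := by have := Real.add_one_le_exp (-(α * h)); linarith
  have hy0 : 0 < y := by linarith
  have hqj : ∀ j : ℕ, q ^ j = Real.exp (j * h) ^ (-α) := fun j => by
    rw [hq, ← Real.exp_nat_mul, ← Real.exp_mul]; ring_nf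
  -- The lost grid step is the price of replacing the random threshold by `t`; for `j = 0` truncated
  -- subtraction leaves the trivial bound `G ≤ 1`.
  have hup : ∀ j : ℕ, j ≤ L → Real.exp (j * h) ≤ y → G ≤ q ^ (j - 1) + δ := by
    intro j hj hjy
    rcases j with _ | j
    · simp; linarith
    · refine g3.trans ?_
      have h1 := (abs_le.1 (hG j (by omega))).2
      have h2 : (tailCount x n (t * y * Real.exp (-h)) : ℝ) ≤
          tailCount x n (t * Real.exp (j * h)) := by
        exact_mod_cast tailCount_anti x n (by
          rw [mul_assoc]
          gcongr
          have : Real.exp (j * h) = Real.exp ((j + 1 : ℕ) * h) * Real.exp (-h) := by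
            rw [← Real.exp_add]; push_cast; ring_nf
          rw [this]
          gcongr)
      have h3 := div_le_div_of_nonneg_right h2 hk.le
      simp only [Nat.add_sub_cancel]
      linarith
  -- Beyond the grid both tails are small. Otherwise `y` lies between two consecutive grid points,
  -- and monotonicity costs a second step of size at most `α * h`.
  by_cases hyL : Real.exp ((L + 1 : ℕ) * h) ≤ y
  · have h1 := hup L le_rfl (le_trans (Real.exp_le_exp.2 (by push_cast; nlinarith)) hyL)
    have h1' : G ≤ q ^ L + δ + (α * h) := by
      rcases L with _ | L
      · simp at h1 ⊢; nlinarith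
      · simp only [Nat.add_sub_cancel] at h1
        have : q ^ L * (1 - q) ≤ 1 * (α * h) := by
          gcongr
          · exact pow_le_one₀ hq0.le hq1
          · linarith
        rw [pow_succ]
        linarith
    have h2 : y ^ (-α) ≤ q ^ (L + 1) := by
      rw [hqj]
      exact Real.rpow_le_rpow_of_nonpos (Real.exp_pos _) hyL (by linarith)
    have h3 : q ^ (L + 1) ≤ q ^ L := pow_le_pow_of_le_one hq0.le hq1 (by omega)
    have h4 : 0 ≤ G := le_trans (by positivity) g1
    have h5 : 0 < y ^ (-α) := by positivity
    have h6 : 0 < α * h := by positivity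
    rw [abs_le]
    constructor <;> linarith
  · push Not at hyL
    set j := ⌊Real.log y / h⌋₊ with hj
    have hlog : 0 ≤ Real.log y := Real.log_nonneg hy
    have hj1 : Real.exp (j * h) ≤ y := by
      rw [← Real.le_log_iff_exp_le hy0, ← le_div_iff₀ hh]
      exact Nat.floor_le (by positivity)
    have hj2 : y < Real.exp ((j + 1 : ℕ) * h) := by
      rw [← Real.log_lt_iff_lt_exp hy0, ← div_lt_iff₀ hh]
      push_cast
      exact Nat.lt_floor_add_one _
    have hjL : j ≤ L := by
      have := Real.exp_lt_exp.1 (hj1.trans_lt hyL)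
      have := lt_of_mul_lt_mul_right this hh.le
      have : j < L + 1 := by exact_mod_cast this
      omega
    have h1 := hup j hjL hj1
    have h2 : y ^ (-α) ≤ q ^ j := by
      rw [hqj]
      exact Real.rpow_le_rpow_of_nonpos (Real.exp_pos _) hj1 (by linarith)
    have h3 : q ^ (j + 1) ≤ y ^ (-α) := by
      rw [hqj]
      exact Real.rpow_le_rpow_of_nonpos hy0 hj2.le (by linarith)
    have h4 : q ^ (j + 1) - δ ≤ G := by
      refine le_trans ?_ g1
      have h1 := (abs_le.1 (hG (j + 1) (by omega))).1
      have h2 : (tailCount x n (t * Real.exp ((j + 1 : ℕ) * h)) : ℝ) ≤ tailCount x n (t * y) := by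
        exact_mod_cast tailCount_anti x n (by gcongr)
      have h3 := div_le_div_of_nonneg_right h2 hk.le
      linarith
    have h5 : ∀ m : ℕ, q ^ m - q ^ (m + 1) ≤ α * h := fun m => by
      have : q ^ m * (1 - q) ≤ 1 * (α * h) := by
        gcongr
        · exact pow_le_one₀ hq0.le hq1
        · linarith
      rw [pow_succ]
      linarith
    have h6 : 0 < α * h := by positivity
    have h7 : q ^ (j - 1) - q ^ j ≤ α * h := by
      rcases j with _ | j
      · simpa using h6.le
      · exact h5 j
    have h8 := h5 j
    have h9 : 0 < q ^ L := by positivity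
    rw [abs_le]
    constructor <;> linarith

/-- The Riemann sums become geometric sums, with `h / (1 - q)` within `h` of `α⁻¹`. The other `h`
comes from the threshold, `τ` from the excess beyond the grid, and the last term from truncating the
series. -/
theorem abs_hill_sub_le (x : ℕ → ℝ) {n L : ℕ} {t h α δ τ : ℝ} (ht : 0 < t) (hh : 0 < h)
    (hα : 0 < α) (hδ : 0 ≤ δ) (hτ : 0 ≤ τ) (hpos : 0 < tailCount x n t)
    (hlow : tailCount x n t < tailCount x n (t * Real.exp (-h)))
    (hG : ∀ j ≤ L, |(tailCount x n (t * Real.exp (j * h)) : ℝ) / tailCount x n t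
      - Real.exp (-(α * h)) ^ j| ≤ δ)
    (htail : (∑ i : Fin n, logExcess (t * Real.exp (L * h)) (x i)) / tailCount x n t ≤ τ) :
    |hill x n (tailCount x n t) - α⁻¹| ≤
      2 * h + h * L * δ + τ + α⁻¹ * Real.exp (-(α * h)) ^ L := by
  obtain ⟨b1, b2⟩ := hill_bounds x ht hpos hlow
  obtain ⟨s1, s2⟩ := sum_logExcess_bounds x n ht hh L
  have hk : (0 : ℝ) < tailCount x n t := by exact_mod_cast hpos
  have s1' := div_le_div_of_nonneg_right s1 hk.le
  have s2' := div_le_div_of_nonneg_right s2 hk.le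
  rw [add_div, mul_div_assoc, sum_div (range L)] at s1'
  rw [mul_div_assoc, sum_div] at s2'
  set q := Real.exp (-(α * h)) with hq
  have hq0 : 0 < q := Real.exp_pos _
  have hq1 : q < 1 := by rw [hq, ← Real.exp_zero]; exact Real.exp_lt_exp.2 (by nlinarith)
  have hqe : 1 - α * h ≤ q := by have := Real.add_one_le_exp (-(α * h)); linarith
  have hqe2 : (1 + α * h) * q ≤ 1 := by
    have h1 := Real.add_one_le_exp (α * h)
    have h2 : Real.exp (α * h) * q = 1 := by rw [hq, ← Real.exp_add, add_neg_cancel, Real.exp_zero]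
    nlinarith
  have hgeom : (1 - q ^ L) / (1 - q) = ∑ j ∈ range L, q ^ j := by
    rw [geom_sum_eq hq1.ne, div_eq_div_iff (sub_pos.2 hq1).ne' (sub_neg.2 hq1).ne]
    ring
  have hu : ∑ j ∈ range L, (tailCount x n (t * Real.exp (j * h)) : ℝ) / tailCount x n t ≤
      (1 - q ^ L) / (1 - q) + L * δ := by
    rw [hgeom]
    calc _ ≤ ∑ j ∈ range L, (q ^ j + δ) := sum_le_sum fun j hj => by
            have := (abs_le.1 (hG j (mem_range.1 hj).le)).2
            linarith
      _ = _ := by simp [sum_add_distrib]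
  have hl : q * ((1 - q ^ L) / (1 - q)) - L * δ ≤
      ∑ j ∈ range L, (tailCount x n (t * Real.exp ((j + 1 : ℕ) * h)) : ℝ) / tailCount x n t := by
    rw [hgeom, mul_sum]
    calc _ = ∑ j ∈ range L, (q * q ^ j - δ) := by simp [sum_sub_distrib]
      _ ≤ _ := sum_le_sum fun j hj => by
            have := (abs_le.1 (hG (j + 1) (mem_range.1 hj))).1
            rw [pow_succ'] at this
            linarith
  have hqL0 : 0 < q ^ L := by positivity
  have hqL1 : q ^ L ≤ 1 := pow_le_one₀ hq0.le hq1.le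
  have hα' : 0 < α⁻¹ := by positivity
  have c1 : h * ((1 - q ^ L) / (1 - q)) ≤ α⁻¹ + h := by
    rw [← mul_div_assoc, div_le_iff₀ (by linarith)]
    have : α * h ≤ (1 + α * h) * (1 - q) := by linarith
    have h2 := mul_le_mul_of_nonneg_left this hα'.le
    have h3 : α⁻¹ * (α * h) = h := by field_simp
    have h4 : α⁻¹ * ((1 + α * h) * (1 - q)) = (α⁻¹ + h) * (1 - q) := by field_simp
    rw [h3, h4] at h2
    nlinarith
  have c2 : (α⁻¹ - h) * (1 - q ^ L) ≤ h * (q * ((1 - q ^ L) / (1 - q))) := by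
    have h1 : h * (q * ((1 - q ^ L) / (1 - q))) = (h * q / (1 - q)) * (1 - q ^ L) := by ring
    rw [h1]
    refine mul_le_mul_of_nonneg_right ?_ (by linarith)
    · rw [le_div_iff₀ (by linarith)]
      have h4 : (α⁻¹ - h) * (1 - q) = α⁻¹ * ((1 - α * h) * (1 - q)) := by field_simp
      have h3 : h * q = α⁻¹ * (α * h * q) := by field_simp
      rw [h3, h4]
      exact mul_le_mul_of_nonneg_left (by linarith) hα'.le
  have hu' := mul_le_mul_of_nonneg_left hu hh.le
  have hl' := mul_le_mul_of_nonneg_left hl hh.le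
  have hLδ : 0 ≤ h * L * δ := by positivity
  have hαL : 0 < α⁻¹ * q ^ L := by positivity
  rw [abs_le]
  constructor
  · nlinarith
  · nlinarith

end PLFit

/-! ### A good `k` when the counts behave. -/

namespace PLFit

open Finset

theorem exists_ksDist_le (x : ℕ → ℝ) {n L : ℕ} {t e α δ K : ℝ} (ht : 0 < t) (hα : 0 < α)
    (he : 0 < e) (he1 : e ≤ 1 / 10) (hδ : 0 < δ) (hδe : δ ≤ e / 4) (hδL : 4 * δ * L ≤ 1)
    (hqL : Real.exp (-e) ^ L ≤ e) (hK : 0 < K)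
    (hcount : ∀ j < L + 3, |(tailCount x n (t * Real.exp (((j : ℝ) - 1) * (e / α))) : ℝ)
      - K * Real.exp (-(((j : ℝ) - 1) * e))| ≤ δ * K)
    (htail : ∑ i : Fin n, logExcess (t * Real.exp (L * (e / α))) (x i) ≤ K * (e / α / 2)) :
    ∃ k ∈ Icc 1 (n - 1), ksDist x n k ≤ 14 * e := by
  set h := e / α with hh
  have hh0 : 0 < h := by positivity
  have hαh : α * h = e := by rw [hh]; field_simp
  have hk0 := hcount 1 (by omega)
  simp only [Nat.cast_one, sub_self, zero_mul, neg_zero, Real.exp_zero, mul_one] at hk0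
  obtain ⟨hk1, hk2⟩ := abs_le.1 hk0
  have hδK : δ * K ≤ 1 / 2 * K := by gcongr; linarith
  have hk : (0 : ℝ) < tailCount x n t := by linarith
  have hpos : 0 < tailCount x n t := by exact_mod_cast hk
  -- The index `j = 0` of `hcount` is the point `t * exp (-h)`: its count is at least `K * (1 + e -
  -- δ)`, above `K * (1 + δ)` since `δ ≤ e / 4`.
  have hlow : tailCount x n t < tailCount x n (t * Real.exp (-h)) := by
    have h1 := (abs_le.1 (hcount 0 (by omega))).1
    simp only [Nat.cast_zero, zero_sub, neg_mul, one_mul, neg_neg] at h1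
    have h2 := Real.add_one_le_exp e
    have h3 : (tailCount x n t : ℝ) < tailCount x n (t * Real.exp (-h)) := by nlinarith
    exact_mod_cast h3
  have hG : ∀ j ≤ L + 1, |(tailCount x n (t * Real.exp (j * h)) : ℝ) / tailCount x n t
      - Real.exp (-(α * h)) ^ j| ≤ 4 * δ := by
    intro j hj
    have h1 := hcount (j + 1) (by omega)
    simp only [Nat.cast_add, Nat.cast_one, add_sub_cancel_right] at h1
    have h2 : Real.exp (-(α * h)) ^ j = Real.exp (-(j * e)) := by
      rw [← Real.exp_nat_mul, hαh]; ring_nf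
    have h3 : Real.exp (-(j * e)) ≤ 1 := Real.exp_le_one_iff.2 (by
      have : (0 : ℝ) ≤ j * e := by positivity
      linarith)
    have h4 := Real.exp_pos (-(j * e))
    rw [h2, div_sub' hk.ne', abs_div, abs_of_pos hk, div_le_iff₀ hk]
    have h5 : |K * Real.exp (-(j * e)) - tailCount x n t * Real.exp (-(j * e))| ≤ δ * K * 1 := by
      rw [← sub_mul, abs_mul, abs_of_pos h4, abs_sub_comm]
      gcongr
    calc _ ≤ _ := abs_sub_le _ (K * Real.exp (-(j * e))) _
      _ ≤ δ * K + δ * K * 1 := add_le_add h1 h5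
      _ ≤ 4 * δ * tailCount x n t := by nlinarith
  have hH := abs_hill_sub_le x (L := L) (δ := 4 * δ) (τ := h) ht hh0 hα (by linarith) hh0.le
    hpos hlow (fun j hj => hG j (by omega)) (by
      rw [div_le_iff₀ hk]
      nlinarith)
  -- With `h = e * α⁻¹` and `τ = h`, the four error terms are at most `2 * h`, `h`, `h` and `e *
  -- α⁻¹`.
  have hH' : |hill x n (tailCount x n t) - α⁻¹| ≤ 5 * e * α⁻¹ := by
    have h1 : h * L * (4 * δ) ≤ h := by nlinarith
    have h2 : α⁻¹ * Real.exp (-(α * h)) ^ L ≤ α⁻¹ * e := by rw [hαh]; gcongr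
    have h3 : h = e * α⁻¹ := div_eq_mul_inv _ _
    linarith
  have hα' : 0 < α⁻¹ := by positivity
  have hHlow : α⁻¹ / 2 ≤ hill x n (tailCount x n t) := by
    have := (abs_le.1 hH').1
    nlinarith
  have hHpos : 0 < hill x n (tailCount x n t) := by linarith
  refine ⟨tailCount x n t, ?_, ?_⟩
  · have := tailCount_le x n (t * Real.exp (-h))
    rw [mem_Icc]
    omega
  · unfold ksDist
    refine ciSup_le fun ⟨y, hy⟩ => ?_
    have h1 := abs_empirical_tail_sub_le x (y := y) ht hh0 hα (by linarith) hy hpos hlow hG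
    rw [hαh] at h1
    have h2 : |y ^ (-α) - y ^ (-hillEstimator x n (tailCount x n t))| ≤ 10 * e := by
      refine (abs_rpow_neg_sub_le hα (inv_pos.2 hHpos) hy).trans ?_
      rw [inv_inv, div_le_iff₀ (by positivity), abs_sub_comm]
      have : α⁻¹ / 2 ≤ min α⁻¹ (hill x n (tailCount x n t)) := le_min (by linarith) hHlow
      nlinarith
    -- The empirical tail contributes `2 * e + e + 4 * δ ≤ 4 * e`, the exponent `10 * e`.
    calc _ ≤ _ := abs_sub_le _ (y ^ (-α)) _
      _ ≤ _ := add_le_add h1 h2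
      _ ≤ _ := by linarith

end PLFit

/-! ### Chebyshev and Markov bounds. -/

namespace PLFit

open Finset MeasureTheory ProbabilityTheory

/-- Chebyshev's inequality for the tail counts of an i.i.d. sample. -/
theorem measure_tailCount_sub_ge_le {Ω : Type*} [MeasurableSpace Ω] {μ : Measure Ω}
    [IsProbabilityMeasure μ] {X : ℕ → Ω → ℝ} (hX : ∀ i, Measurable (X i))
    (hind : iIndepFun X μ) {s p : ℝ} (hp : ∀ i, μ.real {ω | s < X i ω} = p) (n : ℕ) {c : ℝ}
    (hc : 0 < c) :
    μ {ω | c ≤ |(tailCount (fun i => X i ω) n s : ℝ) - n * p|} ≤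
      ENNReal.ofReal (n * p / c ^ 2) := by
  set f : ℝ → ℝ := (Set.Ioi s).indicator 1 with hf
  have hfm : Measurable f := measurable_one.indicator measurableSet_Ioi
  have hms : ∀ i, MeasurableSet {ω | s < X i ω} := fun i => measurableSet_lt measurable_const (hX i)
  have hcomp : ∀ i, f ∘ X i = {ω | s < X i ω}.indicator 1 := fun i => by
    ext ω
    simp [hf, Set.indicator_apply]
  have hint : ∀ i, ∫ ω, (f ∘ X i) ω ∂μ = p := fun i => by
    rw [hcomp, integral_indicator_one (hms i), hp]
  have hL2 : ∀ i, MemLp (f ∘ X i) 2 μ := fun i => by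
    rw [hcomp]
    exact (memLp_const (1 : ℝ)).indicator (hms i)
  have hvar : ∀ i, variance (f ∘ X i) μ ≤ p := fun i => by
    refine (variance_le_expectation_sq (hL2 i).1).trans ?_
    rw [← hint i]
    refine le_of_eq (integral_congr_ae (Filter.Eventually.of_forall fun ω => ?_))
    simp only [hcomp, Pi.pow_apply, Set.indicator_apply, Pi.one_apply]
    split_ifs <;> simp
  have hS : ∀ ω, (tailCount (fun i => X i ω) n s : ℝ) = (∑ i ∈ range n, f ∘ X i) ω := fun ω => by
    rw [cast_tailCount, Finset.sum_apply,
      Fin.sum_univ_eq_sum_range (fun i => if s < X i ω then (1 : ℝ) else 0)]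
    refine sum_congr rfl fun i _ => ?_
    rw [hcomp]
    simp [Set.indicator_apply]
  have hmean : ∫ ω, (∑ i ∈ range n, f ∘ X i) ω ∂μ = n * p := by
    simp only [Finset.sum_apply]
    rw [integral_finsetSum _ fun i _ => (hL2 i).integrable (by norm_num)]
    rw [sum_congr rfl fun i _ => hint i]
    simp
  have hch := meas_ge_le_variance_div_sq (memLp_finsetSum' (range n) fun i _ => hL2 i) hc
  rw [hmean] at hch
  simp only [hS]
  refine hch.trans (ENNReal.ofReal_le_ofReal ?_)
  rw [IndepFun.variance_sum (fun i _ => hL2 i)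
    fun i _ j _ hij => (hind.indepFun hij).comp hfm hfm]
  gcongr
  calc _ ≤ ∑ i ∈ range n, p := sum_le_sum fun i _ => hvar i
    _ = n * p := by simp

theorem measurable_logExcess (s : ℝ) : Measurable (logExcess s) :=
  Measurable.ite measurableSet_Ioi (by fun_prop) measurable_const

/-- An upper Riemann sum over the infinite grid; values in `ENNReal` allow termwise integration with
no integrability condition. -/
theorem ofReal_logExcess_le {s u h : ℝ} (hs : 0 < s) (hh : 0 < h) :
    ENNReal.ofReal (logExcess s u) ≤
      ∑' m : ℕ, {v | s * Real.exp (m * h) < v}.indicator (fun _ => ENNReal.ofReal h) u := by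
  by_cases hu : s < u
  · have hu0 := hs.trans hu
    have hmem : ∀ m ∈ range ⌈Real.log (u / s) / h⌉₊, s * Real.exp (m * h) < u := fun m hm => by
      have := Nat.lt_ceil.1 (mem_range.1 hm)
      rw [lt_div_iff₀ hh, Real.lt_log_iff_exp_lt (by positivity), lt_div_iff₀ hs] at this
      linarith
    calc ENNReal.ofReal (logExcess s u)
        ≤ ENNReal.ofReal (⌈Real.log (u / s) / h⌉₊ * h) := by
          refine ENNReal.ofReal_le_ofReal ?_
          rw [logExcess, if_pos hu, ← div_le_iff₀ hh]
          exact Nat.le_ceil _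
      _ = ∑ m ∈ range ⌈Real.log (u / s) / h⌉₊, ENNReal.ofReal h := by
          rw [ENNReal.ofReal_mul (by positivity)]
          simp
      _ = ∑ m ∈ range ⌈Real.log (u / s) / h⌉₊,
            {v | s * Real.exp (m * h) < v}.indicator (fun _ => ENNReal.ofReal h) u :=
          sum_congr rfl fun m hm => by simp [hmem m hm]
      _ ≤ _ := ENNReal.sum_le_tsum _
  · simp [logExcess, hu]

/-- Markov's inequality for the total log-excess over a threshold with geometrically decaying
tail. -/
theorem measure_sum_logExcess_ge_le {Ω : Type*} [MeasurableSpace Ω] {μ : Measure Ω}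
    [IsProbabilityMeasure μ] {X : ℕ → Ω → ℝ} (hX : ∀ i, Measurable (X i)) {s h r P : ℝ}
    (hs : 0 < s) (hh : 0 < h) (hr0 : 0 ≤ r) (hr1 : r < 1) (hP : 0 ≤ P)
    (hp : ∀ (i m : ℕ), μ.real {ω | s * Real.exp (m * h) < X i ω} ≤ r ^ m * P) (n : ℕ) {c : ℝ}
    (hc : 0 < c) :
    μ {ω | c ≤ ∑ i : Fin n, logExcess s (X i ω)} ≤
      ENNReal.ofReal (n * (h * P / (1 - r)) / c) := by
  have hmeas : ∀ i, Measurable fun ω => ENNReal.ofReal (logExcess s (X i ω)) := fun i =>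
    ((measurable_logExcess s).comp (hX i)).ennreal_ofReal
  have hone : ∀ i, ∫⁻ ω, ENNReal.ofReal (logExcess s (X i ω)) ∂μ ≤
      ENNReal.ofReal (h * P / (1 - r)) := fun i => by
    have hms : ∀ m : ℕ, MeasurableSet {v : ℝ | s * Real.exp (m * h) < v} := fun m =>
      measurableSet_Ioi
    calc _ ≤ ∫⁻ ω, ∑' m : ℕ, {v | s * Real.exp (m * h) < v}.indicator
              (fun _ => ENNReal.ofReal h) (X i ω) ∂μ :=
            lintegral_mono fun ω => ofReal_logExcess_le hs hh
      _ = ∑' m : ℕ, ∫⁻ ω, {v | s * Real.exp (m * h) < v}.indicator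
              (fun _ => ENNReal.ofReal h) (X i ω) ∂μ :=
            lintegral_tsum fun m =>
              ((measurable_const.indicator (hms m)).comp (hX i)).aemeasurable
      _ ≤ ∑' m : ℕ, ENNReal.ofReal (h * P * r ^ m) := by
            refine ENNReal.tsum_le_tsum fun m => ?_
            have : ∀ ω, {v | s * Real.exp (m * h) < v}.indicator (fun _ => ENNReal.ofReal h)
                (X i ω) = {ω | s * Real.exp (m * h) < X i ω}.indicator
                (fun _ => ENNReal.ofReal h) ω := fun ω => rfl
            simp only [this]
            rw [lintegral_indicator_const (measurableSet_lt measurable_const (hX i)), ← ofReal_measureReal,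
              ← ENNReal.ofReal_mul hh.le]
            refine ENNReal.ofReal_le_ofReal ?_
            rw [mul_assoc, mul_comm P]
            exact mul_le_mul_of_nonneg_left (hp i m) hh.le
      _ = _ := by
            rw [← ENNReal.ofReal_tsum_of_nonneg (fun m => by positivity)
              ((summable_geometric_of_lt_one hr0 hr1).mul_left _), tsum_mul_left,
              tsum_geometric_of_lt_one hr0 hr1, div_eq_mul_inv]
  have hset : {ω | c ≤ ∑ i : Fin n, logExcess s (X i ω)} =
      {ω | ENNReal.ofReal c ≤ ∑ i : Fin n, ENNReal.ofReal (logExcess s (X i ω))} := by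
    ext ω
    simp only [Set.mem_ofPred_eq]
    rw [← ENNReal.ofReal_sum_of_nonneg fun i _ => logExcess_nonneg hs,
      ENNReal.ofReal_le_ofReal_iff (sum_nonneg fun i _ => logExcess_nonneg hs)]
  rw [hset]
  refine (meas_ge_le_lintegral_div
    (Finset.measurable_fun_sum univ fun i : Fin n => fun _ => hmeas i).aemeasurable (by simpa using hc) ENNReal.ofReal_ne_top).trans ?_
  rw [ENNReal.ofReal_div_of_pos hc, lintegral_finsetSum univ fun (i : Fin n) _ => hmeas i]
  gcongr
  calc _ ≤ ∑ i : Fin n, ENNReal.ofReal (h * P / (1 - r)) := sum_le_sum fun i _ => hone i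
    _ = _ := by rw [ENNReal.ofReal_mul (by positivity)]; simp

end PLFit

/-! ### Regular variation and choice of the constants. -/

namespace PLFit

open Finset MeasureTheory ProbabilityTheory Filter

theorem RegularlyVaryingTail.tail_pos {F : ℝ → ℝ} {α : ℝ} (hF : RegularlyVaryingTail F α)
    (hmono : Monotone F) (hle : ∀ x, F x ≤ 1) (t : ℝ) : 0 < 1 - F t := by
  by_contra! h
  have h1 : ∀ s ≥ t, 1 - F s = 0 := fun s hs => by
    have := hmono hs
    have := hle s
    linarith
  -- Where the tail vanishes the ratio is `0 / 0 = 0`, but at `x = 1` its limit is `1`.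
  have h2 := hF 1 one_pos
  rw [Real.one_rpow] at h2
  have h3 : (fun s : ℝ => (1 - F (s * 1)) / (1 - F s)) =ᶠ[atTop] fun _ => 0 := by
    filter_upwards [eventually_ge_atTop t] with s hs
    rw [h1 s hs, div_zero]
  exact one_ne_zero (tendsto_nhds_unique h2 (tendsto_const_nhds.congr' h3.symm))

/-- A geometric Potter-type bound. -/
theorem RegularlyVaryingTail.eventually_geometric {F : ℝ → ℝ} {α h r : ℝ}
    (hF : RegularlyVaryingTail F α) (hpos : ∀ t, 0 < 1 - F t) (hh : 0 < h)
    (hr : Real.exp (-(α * h)) < r) :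
    ∀ᶠ T in atTop, ∀ t ≥ T, ∀ m : ℕ, 1 - F (t * Real.exp (m * h)) ≤ r ^ m * (1 - F t) := by
  have h1 := hF (Real.exp h) (Real.exp_pos h)
  rw [← Real.exp_mul, show h * -α = -(α * h) by ring] at h1
  -- The bound for the single ratio `exp h` iterates, since every `t * exp (m * h)` stays beyond
  -- `T₀`.
  obtain ⟨T₀, hT₀⟩ := eventually_atTop.1 (h1.eventually_lt_const hr)
  filter_upwards [eventually_ge_atTop (max T₀ 0)] with T hT t ht m
  have ht0 : 0 ≤ t := (le_max_right _ _).trans (hT.trans ht)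
  have htT : T₀ ≤ t := (le_max_left _ _).trans (hT.trans ht)
  have hr0 : 0 < r := (Real.exp_pos _).trans hr
  induction m with
  | zero => simp
  | succ m ih =>
    have h2 : t ≤ t * Real.exp (m * h) :=
      le_mul_of_one_le_right ht0 (Real.one_le_exp (by positivity))
    have h3 := hT₀ _ (htT.trans h2)
    rw [div_lt_iff₀ (hpos _)] at h3
    have h4 : t * Real.exp ((m + 1 : ℕ) * h) = t * Real.exp (m * h) * Real.exp h := by
      rw [mul_assoc, ← Real.exp_add]
      push_cast
      ring_nf
    rw [h4, pow_succ']
    calc _ ≤ _ := h3.le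
      _ ≤ r * (r ^ m * (1 - F t)) := by gcongr
      _ = _ := by ring

theorem eventually_measure_ksDist_ge_le {Ω : Type*} [MeasurableSpace Ω] {μ : Measure Ω}
    [IsProbabilityMeasure μ] {F : ℝ → ℝ} {α : ℝ} {X : ℕ → Ω → ℝ} (hα : 0 < α)
    (hFcont : Continuous F) (hFtail : RegularlyVaryingTail F α)
    (hXmeas : ∀ i, Measurable (X i)) (hXindep : iIndepFun X μ)
    (hXdist : ∀ (i : ℕ) (x : ℝ), μ.real {ω | X i ω ≤ x} = F x) {ε η : ℝ} (hε : 0 < ε)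
    (hη : 0 < η) :
    ∀ᶠ n : ℕ in atTop,
      μ {ω | ε ≤ ksDist (fun i => X i ω) n (kappaStar (fun i => X i ω) n)} ≤
        ENNReal.ofReal η := by
  have hmono : Monotone F := fun a b hab => by
    rw [← hXdist 0, ← hXdist 0]
    exact measureReal_mono fun ω (hω : X 0 ω ≤ a) => hω.trans hab
  have hle : ∀ x, F x ≤ 1 := fun x => by rw [← hXdist 0]; exact measureReal_le_one
  have htail : ∀ (i : ℕ) (s : ℝ), μ.real {ω | s < X i ω} = 1 - F s := fun i s => by
    rw [← hXdist i, ← probReal_compl_eq_one_sub (measurableSet_le (hXmeas i) measurable_const)]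
    congr 1
    ext ω
    simp
  have hpos := hFtail.tail_pos hmono hle
  set e := min (ε / 15) (1 / 10) with he
  have he0 : 0 < e := by positivity
  have he1 : e ≤ 1 / 10 := min_le_right _ _
  have heε : 14 * e < ε := by have := min_le_left (ε / 15) (1 / 10); linarith
  have hh : 0 < e / α := by positivity
  have hαh : α * (e / α) = e := by field_simp
  have hq0 := Real.exp_pos (-e)
  have hq1 : Real.exp (-e) < 1 := by
    rw [← Real.exp_zero]
    exact Real.exp_lt_exp.2 (by linarith)
  obtain ⟨r, hqr, hr1⟩ := exists_between hq1
  have hr0 : 0 < r := hq0.trans hqr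
  obtain ⟨L, hL1, hL2⟩ : ∃ L : ℕ, Real.exp (-e) ^ L < e ∧ r ^ L < η / 4 * (1 - r) :=
    (((tendsto_pow_atTop_nhds_zero_of_lt_one hq0.le hq1).eventually_lt_const he0).and
      ((tendsto_pow_atTop_nhds_zero_of_lt_one hr0.le hr1).eventually_lt_const
        (mul_pos (by positivity) (by linarith)))).exists
  obtain ⟨δ, hδ0, hδe, hδL⟩ : ∃ δ : ℝ, 0 < δ ∧ δ ≤ e / 4 ∧ 4 * δ * L ≤ 1 := by
    refine ⟨min (e / 4) (1 / (4 * (L + 1))), by positivity, min_le_left _ _, ?_⟩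
    calc 4 * min (e / 4) (1 / (4 * ((L : ℝ) + 1))) * L
        ≤ 4 * (1 / (4 * ((L : ℝ) + 1))) * L := by gcongr; exact min_le_right _ _
      _ ≤ 1 := by field_simp; linarith
  obtain ⟨T, hTgrid, hTgeo, hT0⟩ : ∃ T : ℝ, (∀ t ≥ T, ∀ j ∈ range (L + 3),
      |(1 - F (t * Real.exp (((j : ℝ) - 1) * (e / α)))) / (1 - F t)
        - Real.exp (-(((j : ℝ) - 1) * e))| < δ / 2) ∧
      (∀ t ≥ T, ∀ m : ℕ, 1 - F (t * Real.exp (m * (e / α))) ≤ r ^ m * (1 - F t)) ∧ 0 < T := by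
    have h1 : ∀ᶠ t in atTop, ∀ j ∈ range (L + 3),
        |(1 - F (t * Real.exp (((j : ℝ) - 1) * (e / α)))) / (1 - F t)
          - Real.exp (-(((j : ℝ) - 1) * e))| < δ / 2 := by
      rw [eventually_all_finset]
      intro j _
      have h2 := hFtail _ (Real.exp_pos (((j : ℝ) - 1) * (e / α)))
      rw [← Real.exp_mul, show ((j : ℝ) - 1) * (e / α) * -α = -(((j : ℝ) - 1) * e) by
        field_simp] at h2
      simpa [Real.dist_eq] using Metric.tendsto_nhds.1 h2 (δ / 2) (by positivity)
    exact ((eventually_forall_ge_atTop.2 h1).and ((hFtail.eventually_geometric hpos hh (by rwa [hαh])).and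
      (eventually_gt_atTop 0))).exists
  -- Makes the `L + 3` Chebyshev bounds `16 / (δ ^ 2 * K)` add up to `η / 2`.
  set K : ℝ := 32 * (L + 3) / (δ ^ 2 * η) with hK
  have hK0 : 0 < K := by positivity
  have hlarge : ∀ᶠ n : ℕ in atTop, K < n * (1 - F T) :=
    (tendsto_natCast_atTop_atTop.atTop_mul_const (hpos T)).eventually_gt_atTop K
  filter_upwards [hlarge, eventually_ge_atTop 2] with n hn hn2
  have hn0 : (0 : ℝ) < n := by positivity
  -- Intermediate value theorem: `n * (1 - F s)` exceeds `K` at `T` and, by the geometric bound,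
  -- falls below `K` further out.
  obtain ⟨t, htT, htK⟩ : ∃ t ≥ T, n * (1 - F t) = K := by
    obtain ⟨m, hm⟩ : ∃ m : ℕ, r ^ m * (1 - F T) < K / n :=
      Eventually.exists (Tendsto.eventually_lt_const (v := 0) (by positivity) (by
        simpa using (tendsto_pow_atTop_nhds_zero_of_lt_one hr0.le hr1).mul_const (1 - F T)))
    have h1 := (hTgeo T le_rfl m).trans_lt hm
    rw [lt_div_iff₀ hn0] at h1
    have h2 : T ≤ T * Real.exp (m * (e / α)) :=
      le_mul_of_one_le_right hT0.le (Real.one_le_exp (by positivity))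
    obtain ⟨t, ht, htK⟩ := intermediate_value_Icc' (f := fun s => n * (1 - F s)) h2
      (by fun_prop) ⟨by linarith, hn.le⟩
    exact ⟨t, ht.1, htK⟩
  have ht0 : 0 < t := hT0.trans_le htT
  -- Half of the tolerance `δ * K` is for the random fluctuation, half for the error in regular
  -- variation. An inclusion suffices, so `ksDist` need not be measurable.
  have hsub : {ω | ε ≤ ksDist (fun i => X i ω) n (kappaStar (fun i => X i ω) n)} ⊆
      (⋃ j ∈ range (L + 3), {ω | δ * K / 2 ≤
        |(tailCount (fun i => X i ω) n (t * Real.exp (((j : ℝ) - 1) * (e / α))) : ℝ)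
          - n * (1 - F (t * Real.exp (((j : ℝ) - 1) * (e / α))))|}) ∪
      {ω | K * (e / α / 2) ≤
        ∑ i : Fin n, logExcess (t * Real.exp (L * (e / α))) (X i ω)} := by
    intro ω hω
    by_contra hbad
    simp only [Set.mem_union, Set.mem_iUnion, Set.mem_ofPred_eq, not_or, not_exists, not_le] at hbad
    obtain ⟨hb1, hb2⟩ := hbad
    obtain ⟨k, hk, hks⟩ := exists_ksDist_le (fun i => X i ω) (n := n) ht0 hα he0 he1 hδ0 hδe hδL
      hL1.le hK0 (fun j hj => by
        have h1 := hb1 j (mem_range.2 hj)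
        have h2 := hTgrid t htT j (mem_range.2 hj)
        have h3 : |n * (1 - F (t * Real.exp (((j : ℝ) - 1) * (e / α))))
            - K * Real.exp (-(((j : ℝ) - 1) * e))| ≤ δ / 2 * K := by
          have h4 : n * (1 - F (t * Real.exp (((j : ℝ) - 1) * (e / α)))) =
              K * ((1 - F (t * Real.exp (((j : ℝ) - 1) * (e / α)))) / (1 - F t)) := by
            rw [← htK]
            field_simp [(hpos t).ne']
          rw [h4, ← mul_sub, abs_mul, abs_of_pos hK0, mul_comm]
          exact mul_le_mul_of_nonneg_right h2.le hK0.le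
        refine (abs_sub_le _ _ _).trans ((add_le_add h1.le h3).trans ?_)
        linarith) hb2.le
    have := (kappaStar_spec (fun i => X i ω) hn2).2 k hk
    have : ε ≤ _ := hω
    linarith
  refine (measure_mono hsub).trans ((measure_union_le _ _).trans ?_)
  have hA : ∀ j ∈ range (L + 3), μ {ω | δ * K / 2 ≤
        |(tailCount (fun i => X i ω) n (t * Real.exp (((j : ℝ) - 1) * (e / α))) : ℝ)
          - n * (1 - F (t * Real.exp (((j : ℝ) - 1) * (e / α))))|} ≤
      ENNReal.ofReal (16 / (δ ^ 2 * K)) := by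
    intro j hj
    refine (measure_tailCount_sub_ge_le hXmeas hXindep (fun i => htail i _) n
      (by positivity)).trans (ENNReal.ofReal_le_ofReal ?_)
    have h2 := (abs_lt.1 (hTgrid t htT j hj)).2
    -- The exponent is positive only at `j = 0`, where it equals `e ≤ 1`.
    have h3 : Real.exp (-(((j : ℝ) - 1) * e)) ≤ 3 := by
      refine (Real.exp_le_exp.2 ?_).trans Real.exp_one_lt_three.le
      have : (0 : ℝ) ≤ j * e := by positivity
      linarith
    have h5 : (1 - F (t * Real.exp (((j : ℝ) - 1) * (e / α)))) / (1 - F t) ≤ 4 := by linarith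
    rw [div_le_iff₀ (hpos t)] at h5
    have h6 : n * (1 - F (t * Real.exp (((j : ℝ) - 1) * (e / α)))) ≤ 4 * K := by
      rw [← htK]
      nlinarith
    calc _ ≤ 4 * K / (δ * K / 2) ^ 2 := by gcongr
      _ = _ := by field_simp; norm_num
  have hB : μ {ω | K * (e / α / 2) ≤
        ∑ i : Fin n, logExcess (t * Real.exp (L * (e / α))) (X i ω)} ≤
      ENNReal.ofReal (η / 2) := by
    -- The factor `r ^ L` is the decay already gained between `t` and the end of the grid; `hL2`
    -- then makes the bound at most `η / 2`.
    refine (measure_sum_logExcess_ge_le hXmeas (r := r) (P := r ^ L * (1 - F t)) (by positivity) hh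
      hr0.le hr1 (mul_nonneg (by positivity) (hpos t).le) (fun i m => ?_) n
      (by positivity)).trans (ENNReal.ofReal_le_ofReal ?_)
    · rw [htail, mul_assoc t, ← Real.exp_add, ← mul_assoc, ← pow_add, add_comm m L, ← add_mul,
        ← Nat.cast_add]
      exact hTgeo t htT _
    · have h1 : n * (e / α * (r ^ L * (1 - F t)) / (1 - r)) / (K * (e / α / 2)) =
          2 * (r ^ L / (1 - r)) := by
        have := (sub_pos.2 hr1).ne'
        rw [← htK]
        have := (hpos t).ne'
        field_simp
      have h2 : r ^ L / (1 - r) ≤ η / 4 := by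
        rw [div_le_iff₀ (by linarith)]
        exact hL2.le
      rw [h1]
      linarith
  calc _ ≤ ∑ j ∈ range (L + 3), ENNReal.ofReal (16 / (δ ^ 2 * K)) + ENNReal.ofReal (η / 2) :=
        add_le_add ((measure_biUnion_finset_le _ _).trans (sum_le_sum hA)) hB
    _ = ENNReal.ofReal ((L + 3 : ℕ) * (16 / (δ ^ 2 * K)) + η / 2) := by
        rw [ENNReal.ofReal_add (by positivity) (by positivity),
          ENNReal.ofReal_mul (by positivity), ENNReal.ofReal_natCast, sum_const, card_range,
          nsmul_eq_mul]
    _ = ENNReal.ofReal η := by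
        congr 1
        rw [hK]
        push_cast
        field_simp
        ring

end PLFit

theorem mainTheorem3 {Ω : Type*} [MeasurableSpace Ω] (μ : MeasureTheory.Measure Ω)
    [MeasureTheory.IsProbabilityMeasure μ]
    (F : ℝ → ℝ) (α : ℝ) (X : ℕ → Ω → ℝ)
    (hα : 0 < α)
    (hFcont : Continuous F)
    (hFsupp : ∀ x : ℝ, x < 1 → F x = 0)
    (hFtail : PLFit.RegularlyVaryingTail F α)
    (hXmeas : ∀ i, Measurable (X i))
    (hXindep : ProbabilityTheory.iIndepFun X μ)
    (hXdist : ∀ (i : ℕ) (x : ℝ), μ.real {ω | X i ω ≤ x} = F x) :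
    MeasureTheory.TendstoInMeasure μ
      (fun (n : ℕ) (ω : Ω) =>
        PLFit.ksDist (fun i => X i ω) n (PLFit.kappaStar (fun i => X i ω) n))
      Filter.atTop (fun _ => (0 : ℝ)) := by
  rw [MeasureTheory.tendstoInMeasure_iff_dist]
  intro ε hε
  rw [ENNReal.tendsto_nhds_zero]
  intro c hc
  obtain ⟨η, hη, hηc⟩ : ∃ η : ℝ, 0 < η ∧ ENNReal.ofReal η ≤ c := by
    obtain ⟨r, hr0, hrc⟩ := ENNReal.lt_iff_exists_nnreal_btwn.1 hc
    exact ⟨r, by simpa using hr0, by simpa using hrc.le⟩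
  filter_upwards [PLFit.eventually_measure_ksDist_ge_le hα hFcont hFtail hXmeas hXindep hXdist hε
    hη] with n hn
  refine (MeasureTheory.measure_mono fun ω hω => ?_).trans (hn.trans hηc)
  have h0 : 0 ≤ PLFit.ksDist (fun i => X i ω) n (PLFit.kappaStar (fun i => X i ω) n) :=
    Real.iSup_nonneg fun _ => abs_nonneg _
  simpa [Real.dist_eq, abs_of_nonneg h0] using hω
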